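/- Let $A$ be a Noetherian integral domain with field of fractions $\mathrm{Quot}(A)$, let $R$ be a Noetherian commutative ring containing $A$ as a subring, let $\mathfrak p\subset R$ be a prime ideal with $\mathfrak p\cap A=0$, let $k(\mathfrak p)=R_{\mathfrak p}/\mathfrak pR_{\mathfrak p}$, and let $M$ be a finitely generated $R$-module. For $R$-modules $M,N$, the group $\mathrm{Hom}_A(M,N)$ is an $(R\otimes_A R)$-module through $((r\otimes s)\delta)(m)=r\,\delta(sm)$. Put $[\delta,r](m)=\delta(rm)-r\delta(m)$, $\mathrm{Diff}^{-1}_{R/A}(M,N)=0$, and, for $n\ge 0$, $\mathrm{Diff}^{n}_{R/A}(M,N)=\{\delta\in\mathrm{Hom}_A(M,N) : [\delta,r]\in\mathrm{Diff}^{n-1}_{R/A}(M,N)\text{ for all }r\in R\}$; let $\mathrm{Diff}_{R/A}(M,N)=\bigcup_{n\ge0}\mathrm{Diff}^n_{R/A}(M,N)$. These are $(R\otimes_A R)$-submodules of $\mathrm{Hom}_A(M,N)$. For a set $\mathcal E$ of operators let $\mathrm{Sol}(\mathcal E)=\{m\in M : \delta(m)=0\text{ for all }\delta\in\mathcal E\}$.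 A submodule $U\subsetneq M$ is $\mathfrak p$-primary if $rm\in U$ with $m\notin U$ implies $r^jM\subseteq U$ for some $j$, and $\sqrt{\mathrm{Ann}_R(M/U)}=\mathfrak p$. A field extension $K/k$ (not necessarily algebraic) is separable if $L\otimes_kK$ is reduced for every field extension $L/k$. (i) Suppose that $k(\mathfrak p)\otimes_{\mathrm{Quot}(A)}R_{\mathfrak p}$ is a Noetherian ring. If $U\subset M$ is a $\mathfrak p$-primary $R$-submodule, then there is an $(R\otimes_AR)$-submodule $\mathcal E\subseteq\mathrm{Diff}_{R/A}(M,k(\mathfrak p))$ such that $U=\mathrm{Sol}(\mathcal E)$ and $\mathcal E$ is a finitely generated $R_{\mathfrak p}$-module, where $R_{\mathfrak p}$ acts by $(r\delta)(m)=r\,\delta(m)$. (ii) Suppose that $R$ is essentially of finite type over $A$ (a localization of a finitely generated $A$-algebra) and that $N$ is a nonzero finitely generated torsion-free $R/\mathfrak p$-module. (a) If $U\subset M$ is a $\mathfrak p$-primary $R$-submodule, then there is an $(R\otimes_AR)$-submodule $\mathcal E\subseteq\mathrm{Diff}_{R/A}(M,N)$ such that $U=\mathrm{Sol}(\mathcal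 E)$ and $\mathcal E$ is a finitely generated $R$-module, where $R$ acts by $(r\delta)(m)=r\,\delta(m)$. (b) If $\mathrm{Quot}(A)\hookrightarrow k(\mathfrak p)$ is a separable field extension, which holds whenever $\mathrm{Quot}(A)$ is perfect, then for every $n\ge0$ and every $\mathfrak p$-primary $R$-submodule $U\subset M$ containing $\mathfrak p^{n+1}M$ there is an $(R\otimes_AR)$-submodule $\mathcal E\subseteq\mathrm{Diff}^n_{R/A}(M,N)$ such that $U=\mathrm{Sol}(\mathcal E)$. -/

import Mathlib

open scoped TensorProduct

universe u v w x

noncomputable section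

namespace DiffOp

section Operators

variable (A : Type u) (R : Type v) (M : Type w) (N : Type x)
variable [CommRing A] [CommRing R] [Algebra A R]
variable [AddCommGroup M] [Module A M] [Module R M] [IsScalarTower A R M]
variable [AddCommGroup N] [Module A N] [Module R N] [IsScalarTower A R N]

/-- Precomposition with multiplication by `s : R` on `M`, as an action of `R` on `Hom_A(M, N)`. -/
def preMul : R →ₐ[A] Module.End A (M →ₗ[A] N) :=
  AlgHom.ofLinearMap
    { toFun := fun s =>
        { toFun := fun δ => δ ∘ₗ Algebra.lsmul A A M s
          map_add' := fun _ _ => rfl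
          map_smul' := fun _ _ => rfl }
      map_add' := fun s t => by
        ext δ m
        simp
      map_smul' := fun a s => by
        ext δ m
        simp }
    (by ext δ m; simp)
    (fun s t => by
      ext δ m
      simp [smul_comm s t m])

/-- The action of `R ⊗_A R` on `Hom_A(M, N)`, as a ring homomorphism: the left factor acts by
postcomposition, the right factor by precomposition. -/
def tensorAct : (R ⊗[A] R) →ₐ[A] Module.End A (M →ₗ[A] N) :=
  Algebra.TensorProduct.lift (Algebra.lsmul A A (M →ₗ[A] N)) (preMul A R M N)
    (fun r s => by
      ext δ m
      simp [preMul])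

/-- `Hom_A(M, N)` as an `(R ⊗_A R)`-module; see `tmul_smul_apply` for the action. -/
instance homModule : Module (R ⊗[A] R) (M →ₗ[A] N) :=
  Module.compHom (M →ₗ[A] N) (tensorAct A R M N).toRingHom

variable {A R M N}

/-- `((r ⊗ s) δ)(m) = r δ(s m)`. -/
theorem tmul_smul_apply (r s : R) (δ : M →ₗ[A] N) (m : M) :
    ((r ⊗ₜ[A] s) • δ) m = r • δ (s • m) := by
  change (tensorAct A R M N (r ⊗ₜ[A] s) δ) m = _
  simp [tensorAct, preMul]

/-- The bracket `[δ, r](m) = δ(r m) - r δ(m)`. -/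
def bracket (δ : M →ₗ[A] N) (r : R) : M →ₗ[A] N where
  toFun m := δ (r • m) - r • δ m
  map_add' m m' := by simp only [smul_add, map_add]; abel
  map_smul' a m := by
    rw [smul_comm r a m, δ.map_smul, δ.map_smul, smul_comm r a (δ m), smul_sub, RingHom.id_apply]

theorem bracket_eq (δ : M →ₗ[A] N) (r : R) :
    bracket δ r = ((1 : R) ⊗ₜ[A] r - r ⊗ₜ[A] (1 : R)) • δ := by
  ext m
  rw [sub_smul, LinearMap.sub_apply, tmul_smul_apply, tmul_smul_apply, one_smul, one_smul]
  rfl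

variable (A R M N)

/-- Differential operators with the order shifted by one: the `k`-th term is
`Diff^{k-1}_{R/A}(M, N)`, starting from `Diff^{-1} = 0`. -/
def diffAux : ℕ → Submodule (R ⊗[A] R) (M →ₗ[A] N)
  | 0 => ⊥
  | k + 1 =>
    { carrier := {δ | ∀ r : R, bracket δ r ∈ diffAux k}
      zero_mem' := fun r => by
        rw [bracket_eq, smul_zero]
        exact zero_mem _
      add_mem' := fun {δ ε} hδ hε r => by
        rw [bracket_eq, smul_add, ← bracket_eq, ← bracket_eq]
        exact add_mem (hδ r) (hε r)
      smul_mem' := fun t δ hδ r => by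
        rw [bracket_eq, smul_comm, ← bracket_eq]
        exact Submodule.smul_mem _ t (hδ r) }

/-- `Diff^n_{R/A}(M, N)`: the `A`-linear differential operators of order at most `n`. -/
def Diff (n : ℕ) : Submodule (R ⊗[A] R) (M →ₗ[A] N) :=
  diffAux A R M N (n + 1)

variable {A R M N}

theorem diffAux_mono : Monotone (diffAux A R M N) :=
  monotone_nat_of_le_succ fun k δ hδ r => by
    rw [bracket_eq]
    exact Submodule.smul_mem _ _ hδ

variable (A R M N)

/-- `Diff_{R/A}(M, N)`: the union over `n ≥ 0` of the operators of order at most `n`. -/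
def DiffAll : Submodule (R ⊗[A] R) (M →ₗ[A] N) where
  carrier := {δ | ∃ n : ℕ, δ ∈ Diff A R M N n}
  zero_mem' := ⟨0, zero_mem _⟩
  add_mem' := by
    rintro δ ε ⟨m, hm⟩ ⟨n, hn⟩
    exact ⟨max m n, add_mem (diffAux_mono (by omega) hm) (diffAux_mono (by omega) hn)⟩
  smul_mem' := by
    rintro t δ ⟨n, hn⟩
    exact ⟨n, Submodule.smul_mem _ t hn⟩

variable {A M N}

/-- The solution set `Sol(E)`: the common zeros of the operators in `E`. -/
def Sol (E : Set (M →ₗ[A] N)) : Set M :=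
  {m | ∀ δ ∈ E, δ m = 0}

/-- `E ⊆ Hom_A(M, N)` is a finitely generated `S`-submodule, where the ring `S` acts on
`Hom_A(M, N)` through its action on `N` (postcomposition). -/
def FGLeft (S : Type*) [CommRing S] [Module S N] [SMulCommClass A S N]
    (E : Set (M →ₗ[A] N)) : Prop :=
  ∃ E' : Submodule S (M →ₗ[A] N), E'.FG ∧ (E' : Set (M →ₗ[A] N)) = E

end Operators

/-- `U` is a `p`-primary submodule of `M`: it is primary (in particular proper), and the radical of
`Ann_R(M / U) = (U : M)` is `p`. -/
def IsPrimaryFor {R : Type v} {M : Type w} [CommRing R] [AddCommGroup M] [Module R M]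
    (p : Ideal R) (U : Submodule R M) : Prop :=
  U.IsPrimary ∧ (U.colon Set.univ).radical = p

/-- A (not necessarily algebraic) field extension `K / k` is separable if `L ⊗_k K` is reduced for
every field extension `L / k`. The universe of `k` already contains an algebraic closure of `k`, and
it suffices to test that one field, so restricting `L` to it loses nothing. -/
def IsSeparableExt (k : Type u) (K : Type v) [Field k] [Field K] [Algebra k K] : Prop :=
  ∀ (L : Type u) [Field L] [Algebra k L], IsReduced (L ⊗[k] K)

section Quot

variable {A : Type u} {R : Type v} [CommRing A] [IsDomain A] [CommRing R] [Algebra A R]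

/-- If `p ∩ A = 0`, the canonical homomorphism `Quot(A) → R_p`. -/
def quotToLocal (p : Ideal R) [p.IsPrime] (hp : p.comap (algebraMap A R) = ⊥) :
    FractionRing A →+* Localization.AtPrime p :=
  IsLocalization.lift (M := nonZeroDivisors A) (g := algebraMap A (Localization.AtPrime p))
    (fun y => by
      rw [IsScalarTower.algebraMap_apply A R (Localization.AtPrime p)]
      refine IsLocalization.map_units (M := p.primeCompl) (Localization.AtPrime p)
        ⟨algebraMap A R y, fun hy => ?_⟩
      have h : (y : A) ∈ p.comap (algebraMap A R) := hy
      rw [hp] at h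
      exact nonZeroDivisors.coe_ne_zero y h)

/-- If `p ∩ A = 0`, the canonical `Quot(A)`-algebra structure on `R_p`. It induces the one on
`k(p)`. -/
abbrev quotAlgebra (p : Ideal R) [p.IsPrime] (hp : p.comap (algebraMap A R) = ⊥) :
    Algebra (FractionRing A) (Localization.AtPrime p) :=
  (quotToLocal p hp).toAlgebra

end Quot

end DiffOp

end

/-!
Write `S = R_p`, `K = k(p)`, `k = Quot(A)`, and let `W` be the localization of `M / U` at `p`. Since
`U` is `p`-primary, `U` is the kernel of `M → W`, and `W` is an `S`-module of finite length.

Differential operators with values in `K` are produced from functionals (`mem_diffAux_of_functional`,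
`exists_submodule_of_functionals`): if `R` and `K` act on a `K`-space `Y` through a common ring `T`
and agree modulo an ideal `J` of `T` with `J ^ n • Y = 0`, then the pullbacks along an `R`-linear map
`M → Y` of the `K`-functionals on `Y` are operators of order less than `n`, they form an
`R ⊗ R`-submodule, and their common zeros are the kernel of `M → Y`. It remains to find a `Y` for
which this kernel is `U`.

* In general, `T = K ⊗_k S`, with `J` the kernel of `T → K`, and `Y = X / J ^ n X` for
  `X = T ⊗_S W`, which is finite-dimensional because `T` is Noetherian. If `1 ⊗ w` lies in every
  `J ^ n X`, Krull's intersection theorem gives an element of `1 + J` that annihilates it. But `T` is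
  flat over `S`, so for `w ≠ 0` the annihilator of `1 ⊗ w` is extended from that of `w` and lies in
  `J`. As `W` is Artinian, one `n` works for all `w`.
* If `K / k` is finitely generated and separable, then it is separably generated, hence formally
  smooth, and `K` lifts to a coefficient field of `T = S / p ^ (n + 1) S`. If `p ^ (n + 1) M ⊆ U`, the
  ring `T` acts on `Y = W`, with `J` the maximal ideal of `T`, and the bound on the order is `n`.

If `R` is essentially of finite type over `A`, then `R ⊗ R` is Noetherian and finite over `R` modulo
each power of the diagonal ideal. Therefore an operator of bounded order is determined by finitely
many values, and these span its values over `R`. This bounds the size of the spaces of operators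
(`fgLeft_of_le`) and makes it possible to clear denominators, that is, to pass from operators into
`K` to operators into `N` (`exists_mem_diffAux_of_residueField`).
-/

/-! ### Modules annihilated by a power of an ideal -/

/-- A finite module over a Noetherian `K`-algebra `T` that is annihilated by a power of an ideal `J`
with `T / J` finite over `K` is finite over `K`. -/
theorem Module.finite_of_pow_smul_eq_zero {K T : Type*} [CommRing K] [CommRing T] [Algebra K T]
    [IsNoetherianRing T] (J : Ideal T) [Module.Finite K (T ⧸ J)] (n : ℕ) :
    ∀ {Y : Type*} [AddCommGroup Y] [Module T Y] [Module K Y] [IsScalarTower K T Y]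
      [Module.Finite T Y], (∀ t ∈ J ^ n, ∀ y : Y, t • y = 0) → Module.Finite K Y := by
  induction n with
  | zero =>
    intro Y _ _ _ _ _ h
    have : Subsingleton Y :=
      subsingleton_of_forall_eq 0 fun y => by simpa using h 1 (by simp) y
    infer_instance
  | succ n ih =>
    intro Y _ _ _ _ _ h
    let Z : Submodule T Y := J • ⊤
    have hZ : Module.Finite K Z := by
      refine ih fun t ht y => Subtype.ext ?_
      obtain ⟨y, hy⟩ := y
      change t • y = 0
      refine Submodule.smul_induction_on hy (fun j hj z _ => ?_) fun a b ha hb => ?_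
      · rw [smul_smul]
        exact h _ (by rw [pow_succ]; exact Ideal.mul_mem_mul ht hj) z
      · rw [smul_add, ha, hb, add_zero]
    have hQ : Module.Finite K (Y ⧸ Z) := by
      have : Module.Finite (T ⧸ J) (Y ⧸ Z) := .of_restrictScalars_finite T (T ⧸ J) (Y ⧸ Z)
      have : IsScalarTower K (T ⧸ J) (Y ⧸ Z) :=
        .of_algebraMap_smul fun r y => by
          rw [IsScalarTower.algebraMap_apply K T (T ⧸ J), algebraMap_smul, algebraMap_smul]
      exact .trans (T ⧸ J) (Y ⧸ Z)
    have : Module.Finite K (Z.restrictScalars K) := hZ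
    have : Module.Finite K (Y ⧸ Z.restrictScalars K) := hQ
    exact .of_submodule_quotient (Z.restrictScalars K)

namespace DiffOp

/-! ### Operators of bounded order -/

section General

variable {A : Type u} {R : Type v} {M : Type w} {N : Type x}
variable [CommRing A] [CommRing R] [Algebra A R]
variable [AddCommGroup M] [Module A M] [Module R M] [IsScalarTower A R M]
variable [AddCommGroup N] [Module A N] [Module R N] [IsScalarTower A R N]

theorem bracket_apply (δ : M →ₗ[A] N) (r : R) (m : M) :
    bracket δ r m = δ (r • m) - r • δ m := rfl

theorem mem_diffAux_comp {N' : Type*} [AddCommGroup N'] [Module A N'] [Module R N']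
    [IsScalarTower A R N'] (g : N →ₗ[R] N') {n : ℕ} {δ : M →ₗ[A] N}
    (hδ : δ ∈ diffAux A R M N n) : g.restrictScalars A ∘ₗ δ ∈ diffAux A R M N' n := by
  induction n generalizing δ with
  | zero =>
    obtain rfl : δ = 0 := hδ
    rw [LinearMap.comp_zero]
    exact zero_mem _
  | succ n ih =>
    intro r
    convert ih (hδ r) using 1
    ext m
    simp [bracket_apply]

theorem mem_diffAux_of_comp {N' : Type*} [AddCommGroup N'] [Module A N'] [Module R N']
    [IsScalarTower A R N'] (g : N →ₗ[R] N') (hg : Function.Injective g) {n : ℕ}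
    {δ : M →ₗ[A] N} (hδ : g.restrictScalars A ∘ₗ δ ∈ diffAux A R M N' n) :
    δ ∈ diffAux A R M N n := by
  induction n generalizing δ with
  | zero =>
    have h : g.restrictScalars A ∘ₗ δ = 0 := hδ
    refine (Submodule.mem_bot _).2 (LinearMap.ext fun m => hg ?_)
    simpa using LinearMap.congr_fun h m
  | succ n ih =>
    intro r
    refine ih ?_
    convert hδ r using 1
    ext m
    simp [bracket_apply]

/-- A functional on a `T`-module `X` that is semilinear for one ring homomorphism `j₁ : K → T` and
vanishes on `J ^ n • X` is a differential operator of order less than `n` for a second ring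
homomorphism `j₂ : R → T`, provided that the two agree modulo `J`: each bracket multiplies the
argument by some `j₂ r - j₁ r ∈ J`. -/
theorem mem_diffAux_of_functional {K T X : Type*} [CommRing K] [Algebra R K] [Algebra A K]
    [IsScalarTower A R K] [CommRing T] [AddCommGroup X] [Module T X] (j₁ : K →+* T) (j₂ : R →+* T)
    (J : Ideal T) (hJ : ∀ r, j₂ r - j₁ (algebraMap R K r) ∈ J) (ι : M →+ X)
    (hι : ∀ (r : R) m, ι (r • m) = j₂ r • ι m) {n : ℕ} {φ : X →+ K}
    (hφ : ∀ c x, φ (j₁ c • x) = c * φ x) (hφJ : ∀ t ∈ J ^ n, ∀ x, φ (t • x) = 0)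
    {δ : M →ₗ[A] K} (hδ : ∀ m, δ m = φ (ι m)) : δ ∈ diffAux A R M K n := by
  induction n generalizing φ δ with
  | zero =>
    refine (Submodule.mem_bot _).2 (LinearMap.ext fun m => ?_)
    rw [hδ, ← one_smul T (ι m), hφJ 1 (by simp), LinearMap.zero_apply]
  | succ n ih =>
    intro r
    -- The bracket with `r` is given by the functional `x ↦ φ (d • x)`.
    set d := j₂ r - j₁ (algebraMap R K r) with hd
    refine ih (φ := φ.comp (DistribSMul.toAddMonoidHom X d)) (fun c x => ?_) (fun t ht x => ?_)
      fun m => ?_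
    · simp only [AddMonoidHom.coe_comp, Function.comp_apply, DistribSMul.toAddMonoidHom_apply]
      rw [smul_comm, hφ]
    · simp only [AddMonoidHom.coe_comp, Function.comp_apply, DistribSMul.toAddMonoidHom_apply]
      rw [smul_smul]
      exact hφJ _ (by rw [pow_succ']; exact Ideal.mul_mem_mul (hJ r) ht) x
    · simp only [AddMonoidHom.coe_comp, Function.comp_apply, DistribSMul.toAddMonoidHom_apply]
      rw [bracket_apply, hδ, hδ, hι, hd, sub_smul, map_sub, hφ, Algebra.smul_def]

/-- An operator of order less than `n` is annihilated by the `n`-th power of the kernel of the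
multiplication `R ⊗ R → R`. -/
theorem pow_smul_eq_zero {n : ℕ} {δ : M →ₗ[A] N} (hδ : δ ∈ diffAux A R M N n) {t : R ⊗[A] R}
    (ht : t ∈ KaehlerDifferential.ideal A R ^ n) : t • δ = 0 := by
  induction n generalizing δ t with
  | zero =>
    obtain rfl : δ = 0 := hδ
    exact smul_zero t
  | succ n ih =>
    have key : ∀ b ∈ KaehlerDifferential.ideal A R, b • δ ∈ diffAux A R M N n := by
      have : KaehlerDifferential.ideal A R ≤
          (diffAux A R M N n).comap (LinearMap.toSpanSingleton (R ⊗[A] R) _ δ) := by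
        rw [← KaehlerDifferential.span_range_eq_ideal, Ideal.span_le]
        rintro _ ⟨r, rfl⟩
        have := hδ r
        rw [bracket_eq] at this
        exact this
      exact fun b hb => this hb
    rw [pow_succ] at ht
    refine Submodule.mul_induction_on ht (fun a ha b hb => ?_) fun a b ha hb => ?_
    · rw [mul_smul]
      exact ih (key b hb) ha
    · rw [add_smul, ha, hb, add_zero]

theorem smul_smul_hom (r : R) (t : R ⊗[A] R) (δ : M →ₗ[A] N) : (r • t) • δ = r • (t • δ) := by
  have h : r • t = (r ⊗ₜ[A] (1 : R)) * t := by
    rw [Algebra.smul_def, Algebra.TensorProduct.algebraMap_apply, Algebra.algebraMap_self_apply]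
  rw [h, mul_smul]
  ext m
  rw [tmul_smul_apply, one_smul, LinearMap.smul_apply]

theorem smul_comm_hom (r : R) (t : R ⊗[A] R) (δ : M →ₗ[A] N) : t • (r • δ) = r • (t • δ) := by
  have h : r • δ = (r • (1 : R ⊗[A] R)) • δ := by rw [smul_smul_hom, one_smul]
  rw [h, smul_smul, mul_smul_comm, mul_one, smul_smul_hom]

/-! ### Finiteness over algebras essentially of finite type -/

variable (A R) in
/-- Modulo the `n`-th power of the diagonal ideal, `R ⊗_A R` is a finite `R`-module when `R` is
essentially of finite type over `A`. -/
theorem exists_finset_span_diagonal [IsNoetherianRing R] [Algebra.EssFiniteType A R] (n : ℕ) :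
    ∃ s : Finset (R ⊗[A] R), ∀ t, ∃ y ∈ Submodule.span R (s : Set (R ⊗[A] R)),
      t - y ∈ KaehlerDifferential.ideal A R ^ n := by
  have : IsNoetherianRing (R ⊗[A] R) := Algebra.EssFiniteType.isNoetherianRing R _
  let I := KaehlerDifferential.ideal A R
  have : Module.Finite R (R ⊗[A] R ⧸ I) := by
    refine .of_surjective (Algebra.linearMap R (R ⊗[A] R ⧸ I)) fun y => ?_
    obtain ⟨t, rfl⟩ := Ideal.Quotient.mk_surjective y
    refine ⟨Algebra.TensorProduct.lmul' A t, ?_⟩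
    rw [Algebra.linearMap_apply, IsScalarTower.algebraMap_apply R (R ⊗[A] R) (R ⊗[A] R ⧸ I)]
    refine Ideal.Quotient.eq.2 ?_
    change _ ∈ RingHom.ker (Algebra.TensorProduct.lmul' A (S := R))
    rw [RingHom.mem_ker]
    simp
  have : Module.Finite R (R ⊗[A] R ⧸ I ^ n) :=
    Module.finite_of_pow_smul_eq_zero I n fun t ht y => by
      obtain ⟨y, rfl⟩ := Ideal.Quotient.mk_surjective y
      exact Ideal.Quotient.eq_zero_iff_mem.2 (Ideal.mul_mem_right _ _ ht)
  obtain ⟨s, hs⟩ := Module.Finite.fg_top (R := R) (M := R ⊗[A] R ⧸ I ^ n)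
  classical
  choose g hg using Ideal.Quotient.mk_surjective (I := I ^ n)
  refine ⟨s.image g, fun t => ?_⟩
  have ht : Ideal.Quotient.mk (I ^ n) t ∈ Submodule.map
      ((Ideal.Quotient.mkₐ R (I ^ n)).toLinearMap) (Submodule.span R (s.image g : Set _)) := by
    rw [Submodule.map_span, Finset.coe_image, ← Set.image_comp]
    have : (⇑(Ideal.Quotient.mkₐ R (I ^ n)).toLinearMap ∘ g) '' (s : Set _) = s := by
      refine (Set.image_congr fun y _ => hg y).trans (Set.image_id _)
    rw [this, hs]
    trivial
  obtain ⟨y, hy, hyt⟩ := ht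
  exact ⟨y, hy, Ideal.Quotient.eq.1 hyt.symm⟩

/-- The values of an operator of order less than `n` are `R`-combinations of the values
at generators of `M` of finitely many of its `R ⊗_A R`-multiples. -/
theorem apply_mem_span {n : ℕ} {s : Finset (R ⊗[A] R)}
    (hs : ∀ t, ∃ y ∈ Submodule.span R (s : Set (R ⊗[A] R)),
      t - y ∈ KaehlerDifferential.ideal A R ^ n)
    {G : Finset M} (hG : Submodule.span R (G : Set M) = ⊤) {δ : M →ₗ[A] N}
    (hδ : δ ∈ diffAux A R M N n) (m : M) :
    δ m ∈ Submodule.span R ((fun q : (R ⊗[A] R) × M => (q.1 • δ) q.2) '' (s ×ˢ G : Set _)) := by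
  set V := Submodule.span R ((fun q : (R ⊗[A] R) × M => (q.1 • δ) q.2) '' (s ×ˢ G : Set _)) with hV
  have hm : m ∈ Submodule.span R (G : Set M) := by rw [hG]; trivial
  suffices h : ∀ t : R ⊗[A] R, (t • δ) m ∈ V by simpa using h 1
  induction hm using Submodule.span_induction with
  | mem g hg =>
    intro t
    obtain ⟨y, hy, hyt⟩ := hs t
    have : t • δ = y • δ := by
      rw [← sub_eq_zero, ← sub_smul, pow_smul_eq_zero hδ hyt]
    rw [this]
    clear hyt this
    induction hy using Submodule.span_induction with
    | mem y hy => exact Submodule.subset_span ⟨(y, g), ⟨hy, hg⟩, rfl⟩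
    | zero => rw [zero_smul]; exact zero_mem _
    | add a b _ _ ha hb => rw [add_smul]; exact add_mem ha hb
    | smul r a _ ha => rw [smul_smul_hom]; exact V.smul_mem r ha
  | zero => intro t; rw [map_zero]; exact zero_mem _
  | add a b _ _ ha hb => intro t; rw [map_add]; exact add_mem (ha t) (hb t)
  | smul r a _ ha =>
    intro t
    have h : (t • δ) (r • a) = ((t * ((1 : R) ⊗ₜ[A] r)) • δ) a := by
      rw [mul_comm, mul_smul, tmul_smul_apply, one_smul]
    rw [h]
    exact ha _

/-- If `R` is essentially of finite type, spaces of operators of bounded order into a finite module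
are finite over `R`: an operator is determined by finitely many values. -/
theorem fgLeft_of_le [IsNoetherianRing R] [Algebra.EssFiniteType A R] [Module.Finite R M]
    [Module.Finite R N] {n : ℕ} {E : Submodule (R ⊗[A] R) (M →ₗ[A] N)}
    (hE : E ≤ diffAux A R M N n) : FGLeft R (E : Set (M →ₗ[A] N)) := by
  obtain ⟨s, hs⟩ := exists_finset_span_diagonal A R n
  obtain ⟨G, hG⟩ := Module.Finite.fg_top (R := R) (M := M)
  let E' : Submodule R (M →ₗ[A] N) :=
    { carrier := E
      zero_mem' := zero_mem E
      add_mem' := add_mem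
      smul_mem' := fun r δ hδ => by
        have := E.smul_mem (r • (1 : R ⊗[A] R)) hδ
        rwa [smul_smul_hom, one_smul] at this }
  refine ⟨E', ?_, rfl⟩
  let ev : E' →ₗ[R] (s × G → N) :=
    { toFun := fun δ q => ((q.1 : R ⊗[A] R) • (δ : M →ₗ[A] N)) q.2
      map_add' := fun δ ε => by
        ext q
        simp
      map_smul' := fun r δ => by
        ext q
        exact LinearMap.congr_fun (smul_comm_hom r (q.1 : R ⊗[A] R) (δ : M →ₗ[A] N)) q.2 }
  have hev : Function.Injective ev := by
    rw [injective_iff_map_eq_zero]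
    intro δ hδ
    refine Subtype.ext (LinearMap.ext fun m => ?_)
    have hm := apply_mem_span hs hG (hE δ.2) m
    refine (Submodule.mem_bot R).1 (Submodule.span_le.2 ?_ hm)
    rintro _ ⟨⟨t, g⟩, ⟨ht, hg⟩, rfl⟩
    exact congr_fun hδ (⟨t, ht⟩, ⟨g, hg⟩)
  have : Module.Finite R E' := .of_injective ev hev
  exact Module.Finite.iff_fg.1 this

/-- Clearing denominators: an operator into `k(p)` becomes, after multiplication by a nonzero
element of `R ⧸ p`, an operator into `R ⧸ p`, and hence into any `R ⧸ p`-module through a choice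
of an element. -/
theorem exists_mem_diffAux_of_residueField [IsNoetherianRing R] [Algebra.EssFiniteType A R]
    [Module.Finite R M] (p : Ideal R) [p.IsPrime] [Module (R ⧸ p) N] [IsScalarTower R (R ⧸ p) N]
    [Module.IsTorsionFree (R ⧸ p) N] [Nontrivial N] {n : ℕ} {δ : M →ₗ[A] p.ResidueField}
    (hδ : δ ∈ diffAux A R M p.ResidueField n) :
    ∃ ε ∈ diffAux A R M N n, ∀ m, ε m = 0 ↔ δ m = 0 := by
  obtain ⟨s, hs⟩ := exists_finset_span_diagonal A R n
  obtain ⟨G, hG⟩ := Module.Finite.fg_top (R := R) (M := M)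
  classical
  let F : Finset p.ResidueField :=
    (s ×ˢ G).image fun q : (R ⊗[A] R) × M => (q.1 • δ) q.2
  obtain ⟨b, hb⟩ := IsLocalization.exist_integer_multiples_of_finset
    (nonZeroDivisors (R ⧸ p)) F
  -- A nonzero element of the torsion-free module `N` embeds `R ⧸ p` into `N`.
  obtain ⟨y, hy⟩ := exists_ne (0 : N)
  have hinj := p.injective_algebraMap_quotient_residueField
  have hb0 : algebraMap (R ⧸ p) p.ResidueField b ≠ 0 := by
    rw [Ne, map_eq_zero_iff _ hinj]
    exact nonZeroDivisors.coe_ne_zero b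
  let g : (R ⧸ p) →ₗ[R] p.ResidueField :=
    (Algebra.linearMap (R ⧸ p) p.ResidueField).restrictScalars R
  have hrange : ∀ m, (b : R ⧸ p) • δ m ∈ LinearMap.range g := by
    intro m
    have hm := apply_mem_span hs hG hδ m
    have : Submodule.span R ((fun q : (R ⊗[A] R) × M => (q.1 • δ) q.2) '' (s ×ˢ G : Set _)) ≤
        (LinearMap.range g).comap
          ((LinearMap.lsmul (R ⧸ p) p.ResidueField (b : R ⧸ p)).restrictScalars R) := by
      rw [Submodule.span_le]
      rintro _ ⟨q, hq, rfl⟩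
      obtain ⟨c, hc⟩ := hb ((q.1 • δ) q.2) (Finset.mem_image.2 ⟨q, by simpa using hq, rfl⟩)
      exact ⟨c, hc⟩
    exact this hm
  let e := LinearEquiv.ofInjective g hinj
  let δ₀ : M →ₗ[A] (R ⧸ p) := (e.symm.toLinearMap.restrictScalars A) ∘ₗ
    (((LinearMap.lsmul (R ⧸ p) p.ResidueField (b : R ⧸ p)).restrictScalars A ∘ₗ δ).codRestrict
      ((LinearMap.range g).restrictScalars A) hrange)
  have hδ₀ : ∀ m, g (δ₀ m) = (b : R ⧸ p) • δ m := fun m =>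
    congr_arg Subtype.val (e.apply_symm_apply ⟨_, hrange m⟩)
  refine ⟨((LinearMap.toSpanSingleton (R ⧸ p) N y).restrictScalars R).restrictScalars A ∘ₗ δ₀,
    mem_diffAux_comp _ (mem_diffAux_of_comp g hinj ?_), fun m => ?_⟩
  · have := mem_diffAux_comp
      ((LinearMap.lsmul (R ⧸ p) p.ResidueField (b : R ⧸ p)).restrictScalars R) hδ
    convert this using 1
    ext m
    exact hδ₀ m
  · have h1 : δ₀ m • y = 0 ↔ δ₀ m = 0 := smul_eq_zero_iff_left hy
    have h2 : δ₀ m = 0 ↔ g (δ₀ m) = 0 := (map_eq_zero_iff g hinj).symm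
    change δ₀ m • y = 0 ↔ _
    rw [h1, h2, hδ₀, Algebra.smul_def, mul_eq_zero, or_iff_right hb0]

end General

/-! ### Separable field extensions -/

/-- Over an algebraic closure, coefficients have `q`-th roots, so that a linear relation among the
`x ^ q` makes some `∑ d x ⊗ x` nilpotent, and therefore zero. This is the hypothesis of MacLane's
criterion. -/
theorem exists_isTranscendenceBasis_of_isSeparableExt {k : Type u} {K : Type v} [Field k] [Field K]
    [Algebra k K] [Algebra.EssFiniteType k K] (h : IsSeparableExt k K) :
    ∃ s : Finset K, IsTranscendenceBasis k ((↑) : s → K) ∧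
      Algebra.IsSeparable (IntermediateField.adjoin k (s : Set K)) K := by
  obtain _ | ⟨q, hq, hqk⟩ := CharP.exists' k
  · exact exists_isTranscendenceBasis_and_isSeparable_of_perfectField k K
  have : ExpChar k q := .prime hq.out
  let F := AlgebraicClosure k
  have : ExpChar F q := expChar_of_injective_algebraMap (algebraMap k F).injective q
  have : ExpChar (F ⊗[k] K) q := by
    have : Nontrivial (F ⊗[k] K) := inferInstance
    exact expChar_of_injective_algebraMap (algebraMap k (F ⊗[k] K)).injective q
  have hred : IsReduced (F ⊗[k] K) := h F
  refine exists_isTranscendenceBasis_and_isSeparable_of_linearIndepOn_pow_of_essFiniteType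
    q hq.out fun s hs => ?_
  have hs' := hs
  rw [linearIndepOn_finset_iff] at hs ⊢
  intro c hc
  choose d hd using fun x => IsAlgClosed.exists_pow_nat_eq (algebraMap k F (c x)) hq.out.pos
  have hzero : ∑ x ∈ s, d x ⊗ₜ[k] x = 0 := by
    refine eq_zero_of_pow_eq_zero (n := q) ?_
    rw [sum_pow_char]
    simp only [Algebra.TensorProduct.tmul_pow, hd, Algebra.algebraMap_eq_smul_one,
      TensorProduct.smul_tmul]
    rw [← TensorProduct.tmul_sum, hc, TensorProduct.tmul_zero]
  intro x hx
  classical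
  -- Contract `∑ y, d y ⊗ y = 0` with the coordinate function of `x`.
  let b := Module.Basis.extend hs'
  let i (y : K) (hy : y ∈ s) : hs'.extend (Set.subset_univ _) := ⟨y, hs'.subset_extend _ hy⟩
  have hb (y : K) (hy : y ∈ s) : b (i y hy) = y := Module.Basis.extend_apply_self hs' (i y hy)
  have hcoord : ∀ y ∈ s, b.coord (i x hx) y = if y = x then 1 else 0 := by
    intro y hy
    conv_lhs => rw [← hb y hy]
    simp [Finsupp.single_apply, i]
  have h0 := congr_arg (TensorProduct.rid k F ∘ (b.coord (i x hx)).lTensor F) hzero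
  have hdx : d x = 0 := by
    simp only [Function.comp_apply, map_sum, LinearMap.lTensor_tmul, TensorProduct.rid_tmul,
      map_zero] at h0
    rw [Finset.sum_congr rfl fun y hy => by rw [hcoord y hy]] at h0
    simpa [hx] using h0
  have := hd x
  rw [hdx, zero_pow hq.out.ne_zero] at this
  exact (map_eq_zero _).1 this.symm

/-- An algebra that is flat and unramified over a domain embeds into an unramified algebra over the
fraction field. -/
theorem isReduced_tensorProduct_of_flat {D K P : Type*} [CommRing D] [CommRing K] [CommRing P]
    [Algebra D K] [Algebra D P] [IsDomain P] [Algebra.FormallyUnramified D K]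
    [Algebra.EssFiniteType D K] [Module.Flat D K] : IsReduced (K ⊗[D] P) := by
  let F := FractionRing P
  have : IsReduced (F ⊗[D] K) := Algebra.FormallyUnramified.isReduced_of_field F _
  have : IsReduced (K ⊗[D] F) :=
    isReduced_of_injective (Algebra.TensorProduct.comm D K F) (AlgEquiv.injective _)
  refine isReduced_of_injective
    (Algebra.TensorProduct.map (.id D K) (IsScalarTower.toAlgHom D P F)) ?_
  exact Module.Flat.lTensor_preserves_injective_linearMap (M := K)
    (IsScalarTower.toAlgHom D P F).toLinearMap (IsFractionRing.injective P F)

/-- With `D` the polynomial ring on a separating transcendence basis of `K`, the ring `D ⊗ L` is a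
domain, `K` is flat and unramified over `D`, and `L ⊗ K` is `K ⊗_D (D ⊗ L)`. -/
theorem isSeparableExt_of_perfectField {k : Type u} {K : Type v} [Field k] [Field K]
    [Algebra k K] [Algebra.EssFiniteType k K] [PerfectField k] : IsSeparableExt k K := by
  intro L _ _
  obtain ⟨s, hs, hsep⟩ := exists_isTranscendenceBasis_and_isSeparable_of_perfectField k K
  let E := IntermediateField.adjoin k (s : Set K)
  let D := Algebra.adjoin k (s : Set K)
  have e : MvPolynomial s k ≃ₐ[k] D :=
    hs.1.aevalEquiv.trans (Subalgebra.equivOfEq _ _ (by simp [D]))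
  have : Algebra.FormallyEtale D K := by
    open scoped IntermediateField.algebraAdjoinAdjoin in
    have : Algebra.FormallyEtale D E := .of_isLocalization (nonZeroDivisors D)
    have : Algebra.FormallyEtale E K := .of_isSeparable E K
    exact .comp D E K
  have : Module.Flat D K := by
    open scoped IntermediateField.algebraAdjoinAdjoin in
    have : Module.Flat D E := IsLocalization.flat E (nonZeroDivisors D)
    exact .trans D E K
  have : Algebra.EssFiniteType D K := .of_comp k D K
  have : IsDomain (D ⊗[k] L) :=
    ((Algebra.TensorProduct.comm k D L).toRingEquiv.trans
      ((Algebra.TensorProduct.congr (.refl : L ≃ₐ[k] L) e.symm).toRingEquiv.trans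
        (MvPolynomial.algebraTensorAlgEquiv k L).toRingEquiv)).toMulEquiv.isDomain _
  have : IsReduced (K ⊗[D] (D ⊗[k] L)) := isReduced_tensorProduct_of_flat
  have : IsReduced (K ⊗[k] L) :=
    isReduced_of_injective (Algebra.TensorProduct.cancelBaseChange k D D K L).symm
      (AlgEquiv.injective _)
  exact isReduced_of_injective (Algebra.TensorProduct.comm k L K) (AlgEquiv.injective _)

/-- A finitely generated separable extension is separably generated, hence formally smooth. -/
theorem formallySmooth_of_isSeparableExt {k : Type u} {K : Type v} [Field k] [Field K]
    [Algebra k K] [Algebra.EssFiniteType k K] (h : IsSeparableExt k K) :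
    Algebra.FormallySmooth k K := by
  obtain ⟨s, hs, hsep⟩ := exists_isTranscendenceBasis_of_isSeparableExt h
  have : Algebra.IsSeparable (IntermediateField.adjoin k (Set.range ((↑) : s → K))) K := by
    convert! hsep <;> simp
  exact .of_algebraicIndependent_of_isSeparable hs.1

end DiffOp

/-! ### Separation in flat base changes -/

theorem IsLocalRing.isArtinian_of_pow_smul_eq_zero {S W : Type*} [CommRing S] [IsNoetherianRing S]
    [IsLocalRing S] [AddCommGroup W] [Module S W] [Module.Finite S W] {n : ℕ}
    (h : ∀ t ∈ maximalIdeal S ^ n, ∀ y : W, t • y = 0) : IsArtinian S W := by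
  cases subsingleton_or_nontrivial W with
  | inl _ => infer_instance
  | inr _ =>
  let I := maximalIdeal S ^ n
  have hI : I ≠ ⊤ := by
    intro hI
    obtain ⟨y, hy⟩ := exists_ne (0 : W)
    exact hy (by simpa using h 1 (by rw [show maximalIdeal S ^ n = ⊤ from hI]; trivial) y)
  have : Nontrivial (S ⧸ I) := Ideal.Quotient.nontrivial_iff.2 hI
  have : IsLocalRing (S ⧸ I) := .of_surjective' _ Ideal.Quotient.mk_surjective
  have := IsLocalHom.of_surjective (Ideal.Quotient.mk I) Ideal.Quotient.mk_surjective
  have hmap : (maximalIdeal S).map (Ideal.Quotient.mk I) = maximalIdeal (S ⧸ I) := by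
    ext x
    obtain ⟨x, rfl⟩ := Ideal.Quotient.mk_surjective x
    simp [sup_eq_left.mpr (le_maximalIdeal hI)]
  have : IsArtinianRing (S ⧸ I) := by
    rw [isArtinianRing_iff_isNilpotent_maximalIdeal]
    exact ⟨n, by rw [← hmap, ← Ideal.map_pow]; exact Ideal.map_quotient_self I⟩
  let tors : Module.IsTorsionBySet S W I := fun y t => h t t.2 y
  let := tors.module
  have : IsScalarTower S (S ⧸ I) W := tors.isScalarTower
  have : Module.Finite (S ⧸ I) W := .of_restrictScalars_finite S _ _
  have : IsArtinian (S ⧸ I) W := inferInstance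
  exact isArtinian_of_surjective_algebraMap (S := S) (R := S ⧸ I) (M := W)
    Ideal.Quotient.mk_surjective

/-- The annihilator of `1 ⊗ w` in a flat base change is extended from the annihilator of `w`. -/
theorem Module.Flat.mem_of_smul_one_tmul_eq_zero {S T W : Type*} [CommRing S] [CommRing T]
    [Algebra S T] [Module.Flat S T] [AddCommGroup W] [Module S W] {J : Ideal T} {w : W}
    (hJ : ∀ s : S, s • w = 0 → algebraMap S T s ∈ J) {t : T} (ht : t ⊗ₜ[S] w = 0) : t ∈ J := by
  let f := LinearMap.toSpanSingleton S W w
  have hex : Function.Exact (LinearMap.ker f).subtype f := LinearMap.exact_subtype_ker_map f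
  obtain ⟨y, hy⟩ := (Module.Flat.lTensor_exact T hex (t ⊗ₜ[S] (1 : S))).1 (by simpa [f] using ht)
  have key : ∀ y, TensorProduct.rid S T ((LinearMap.ker f).subtype.lTensor T y) ∈ J := by
    intro y
    induction y with
    | zero => simp
    | add a b ha hb => rw [map_add, map_add]; exact add_mem ha hb
    | tmul a b =>
      obtain ⟨b, hb⟩ := b
      rw [LinearMap.lTensor_tmul, TensorProduct.rid_tmul, Submodule.subtype_apply,
        Algebra.smul_def]
      exact J.mul_mem_right _ (hJ b (by simpa [f] using hb))
  have := key y
  rwa [hy, TensorProduct.rid_tmul, one_smul] at this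

/-- In a flat base change to a Noetherian ring, elements of a module of finite length are separated
from zero by a single power of an ideal `J` lying over the maximal ideal. By Krull's intersection
theorem an element `1 ⊗ w` in all powers has an annihilator containing some `1 - r` with `r ∈ J`. -/
theorem exists_pow_forall_one_tmul {S T W : Type*} [CommRing S] [IsLocalRing S] [CommRing T]
    [IsNoetherianRing T] [Algebra S T] [Module.Flat S T] [AddCommGroup W] [Module S W]
    [Module.Finite S W] [IsArtinian S W] {J : Ideal T} (hJ : J ≠ ⊤)
    (hm : ∀ s ∈ IsLocalRing.maximalIdeal S, algebraMap S T s ∈ J) :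
    ∃ n, ∀ w : W, (1 : T) ⊗ₜ[S] w ∈ (J ^ n • ⊤ : Submodule T (T ⊗[S] W)) → w = 0 := by
  -- The preimages in `W` of the submodules `J ^ n • ⊤` form a descending chain.
  let P (n : ℕ) : Submodule T (T ⊗[S] W) := J ^ n • ⊤
  have hP : Antitone P := fun a b hab => Submodule.smul_mono_left (Ideal.pow_le_pow_right hab)
  let V : ℕ →o (Submodule S W)ᵒᵈ :=
    { toFun := fun n =>
        OrderDual.toDual (((P n).restrictScalars S).comap (TensorProduct.mk S T W 1))
      monotone' := fun a b hab w hw => hP hab hw }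
  obtain ⟨n, hn⟩ := IsArtinian.monotone_stabilizes V
  have hV : ∀ i w, w ∈ OrderDual.ofDual (V i) ↔ (1 : T) ⊗ₜ[S] w ∈ P i := fun _ _ => Iff.rfl
  refine ⟨n, fun w hw => ?_⟩
  have hmem : ∀ i, (1 : T) ⊗ₜ[S] w ∈ P i := by
    intro i
    rcases le_total n i with hi | hi
    · rwa [← hV, ← hn i hi, hV]
    · exact hP hi hw
  obtain ⟨r, hr⟩ := (J.mem_iInf_smul_pow_eq_bot_iff ((1 : T) ⊗ₜ[S] w)).1
    ((Submodule.mem_iInf _).2 hmem)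
  by_contra hw0
  have h1 : (1 - (r : T)) ⊗ₜ[S] w = 0 := by
    rw [TensorProduct.sub_tmul, sub_eq_zero, ← hr, TensorProduct.smul_tmul', smul_eq_mul, mul_one]
  have h2 : 1 - (r : T) ∈ J := Module.Flat.mem_of_smul_one_tmul_eq_zero (fun s hs => hm s ?_) h1
  · exact hJ ((Ideal.eq_top_iff_one J).2 (by simpa using add_mem h2 r.2))
  · by_contra hs'
    exact hw0 (((IsLocalRing.notMem_maximalIdeal.1 hs').smul_eq_zero).1 hs)

namespace DiffOp

/-! ### Operators from functionals -/

/-- The functionals on a `K`-space `Y`, pulled back along `ι : M → Y`, form a module of differential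
operators with solution set `ker ι`. The `R`-structure of `Y` comes from a ring `T` in which `R` and
`K` act compatibly up to an ideal `J` that is nilpotent on `Y`. -/
theorem exists_submodule_of_functionals {A R M S K T Y : Type*} [CommRing A] [CommRing R]
    [Algebra A R] [AddCommGroup M] [Module A M] [Module R M] [IsScalarTower A R M]
    [Field K] [Algebra R K] [Algebra A K] [IsScalarTower A R K] [CommRing S] [Algebra S K]
    [SMulCommClass A S K] (hS : Function.Surjective (algebraMap S K)) [CommRing T] [Algebra K T]
    (j : R →+* T) (hj : ∀ a, j (algebraMap A R a) = algebraMap K T (algebraMap A K a))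
    {J : Ideal T} (hJ : ∀ r, j r - algebraMap K T (algebraMap R K r) ∈ J)
    [AddCommGroup Y] [Module T Y] [Module K Y] [IsScalarTower K T Y] (ι : M →+ Y)
    (hι : ∀ (r : R) m, ι (r • m) = j r • ι m) {n : ℕ} (hn : ∀ t ∈ J ^ n, ∀ y : Y, t • y = 0) :
    ∃ E : Submodule (R ⊗[A] R) (M →ₗ[A] K), E ≤ diffAux A R M K n ∧
      Sol (E : Set (M →ₗ[A] K)) = {m | ι m = 0} ∧
      (Module.Finite K Y → FGLeft S (E : Set (M →ₗ[A] K))) := by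
  let Φ : (Y →ₗ[K] K) →ₗ[K] (M →ₗ[A] K) :=
    { toFun := fun φ =>
        { toFun := fun m => φ (ι m)
          map_add' := fun a b => by rw [map_add, map_add]
          map_smul' := fun a m => by
            rw [← algebraMap_smul R a m, hι, hj, algebraMap_smul, map_smul, smul_eq_mul,
              RingHom.id_apply, Algebra.smul_def] }
      map_add' := fun _ _ => rfl
      map_smul' := fun _ _ => rfl }
  have hΦ : ∀ φ m, Φ φ m = φ (ι m) := fun _ _ => rfl
  let E : Submodule (R ⊗[A] R) (M →ₗ[A] K) :=
    { carrier := LinearMap.range Φ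
      zero_mem' := zero_mem (LinearMap.range Φ)
      add_mem' := fun ha hb => add_mem (S := Submodule K (M →ₗ[A] K)) ha hb
      smul_mem' := fun t δ hδ => by
        obtain ⟨φ, rfl⟩ := hδ
        induction t with
        | zero => rw [zero_smul]; exact zero_mem (LinearMap.range Φ)
        | add a b ha hb => rw [add_smul]; exact add_mem (S := Submodule K (M →ₗ[A] K)) ha hb
        | tmul r s =>
          refine ⟨algebraMap R K r • (φ ∘ₗ Algebra.lsmul K K Y (j s)), LinearMap.ext fun m => ?_⟩
          rw [tmul_smul_apply, hΦ, hΦ, hι, LinearMap.smul_apply, algebraMap_smul]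
          rfl }
  refine ⟨E, ?_, ?_, fun _ => ?_⟩
  · rintro _ ⟨φ, rfl⟩
    refine mem_diffAux_of_functional (algebraMap K T) j J hJ ι hι (φ := φ.toAddMonoidHom)
      (fun c y => ?_) (fun t ht y => ?_) fun m => rfl
    · change φ (algebraMap K T c • y) = c * φ y
      rw [algebraMap_smul, map_smul, smul_eq_mul]
    · change φ (t • y) = 0
      rw [hn t ht, map_zero]
  · ext m
    refine ⟨fun h => (Module.forall_dual_apply_eq_zero_iff K (ι m)).1 fun φ => h (Φ φ) ⟨φ, rfl⟩, ?_⟩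
    rintro h _ ⟨φ, rfl⟩
    rw [hΦ, show ι m = 0 from h, map_zero]
  · refine ⟨(LinearMap.range Φ).restrictScalars S, ?_, rfl⟩
    have : Module.Finite S K := .of_surjective (Algebra.linearMap S K) hS
    have : Module.Finite S (LinearMap.range Φ) := .trans K _
    exact Module.Finite.iff_fg.1 this

/-- Separation by operators of some bounded order, for a Noetherian ring `T` in which the local ring
`S` and its residue field `K` both act, compatibly modulo the kernel `J` of a retraction `T → K`: the
operators are the functionals on `(T ⊗ W) / J ^ n (T ⊗ W)`. -/
theorem exists_submodule_of_retraction {A R M S K T W : Type*} [CommRing A] [CommRing R]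
    [Algebra A R] [AddCommGroup M] [Module A M] [Module R M] [IsScalarTower A R M]
    [Field K] [Algebra R K] [Algebra A K] [IsScalarTower A R K] [CommRing S] [IsLocalRing S]
    [Algebra R S] [Algebra S K] [IsScalarTower R S K] [SMulCommClass A S K]
    (hS : Function.Surjective (algebraMap S K))
    (hm : ∀ s ∈ IsLocalRing.maximalIdeal S, algebraMap S K s = 0)
    [CommRing T] [IsNoetherianRing T] [Algebra S T] [Module.Flat S T] [Algebra K T]
    (μ : T →ₐ[K] K) (hμ : ∀ s, μ (algebraMap S T s) = algebraMap S K s)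
    (hA : ∀ a, algebraMap S T (algebraMap R S (algebraMap A R a)) =
      algebraMap K T (algebraMap A K a))
    [AddCommGroup W] [Module S W] [Module.Finite S W] [IsArtinian S W] (ι : M →+ W)
    (hι : ∀ (r : R) m, ι (r • m) = algebraMap R S r • ι m) :
    ∃ (n : ℕ) (E : Submodule (R ⊗[A] R) (M →ₗ[A] K)), E ≤ diffAux A R M K n ∧
      Sol (E : Set (M →ₗ[A] K)) = {m | ι m = 0} ∧ FGLeft S (E : Set (M →ₗ[A] K)) := by
  let J : Ideal T := RingHom.ker μ
  have hJ : J ≠ ⊤ := RingHom.ker_ne_top _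
  obtain ⟨n, hn⟩ := exists_pow_forall_one_tmul (S := S) (W := W) hJ fun s hs => by
    rw [RingHom.mem_ker, hμ, hm s hs]
  let X := T ⊗[S] W
  let Y := X ⧸ (J ^ n • ⊤ : Submodule T X)
  have hY : ∀ t ∈ J ^ n, ∀ y : Y, t • y = 0 := by
    intro t ht y
    obtain ⟨y, rfl⟩ := Submodule.Quotient.mk_surjective _ y
    rw [← Submodule.Quotient.mk_smul]
    exact (Submodule.Quotient.mk_eq_zero _).2 (Submodule.smul_mem_smul ht trivial)
  have : Module.Finite K (T ⧸ J) := by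
    refine .of_surjective (Algebra.linearMap K (T ⧸ J)) fun y => ?_
    obtain ⟨t, rfl⟩ := Ideal.Quotient.mk_surjective y
    refine ⟨μ t, ?_⟩
    rw [Algebra.linearMap_apply, IsScalarTower.algebraMap_apply K T (T ⧸ J)]
    refine Ideal.Quotient.eq.2 ?_
    rw [RingHom.mem_ker, map_sub, AlgHom.commutes, Algebra.algebraMap_self_apply, sub_self]
  have : Module.Finite K Y := Module.finite_of_pow_smul_eq_zero J n hY
  let κ : M →+ Y := ((Submodule.mkQ (J ^ n • ⊤ : Submodule T X)).toAddMonoidHom.comp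
    (TensorProduct.mk S T W 1).toAddMonoidHom).comp ι
  have hκ : ∀ m, κ m = Submodule.Quotient.mk ((1 : T) ⊗ₜ[S] ι m) := fun _ => rfl
  obtain ⟨E, hE, hSol, hfg⟩ := exists_submodule_of_functionals (A := A) (R := R) (M := M) (S := S)
    (K := K) (T := T) hS ((algebraMap S T).comp (algebraMap R S)) (J := J) (Y := Y) hA (fun r => by
      rw [RingHom.mem_ker, map_sub, RingHom.comp_apply, hμ, AlgHom.commutes, sub_eq_zero,
        ← IsScalarTower.algebraMap_apply R S K]
      rfl) κ (fun r m => by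
      rw [hκ, hκ, ← Submodule.Quotient.mk_smul, hι, RingHom.comp_apply,
        TensorProduct.smul_tmul', smul_eq_mul, mul_one,
        ← TensorProduct.smul_tmul, Algebra.smul_def, mul_one]) hY
  refine ⟨n, E, hE, ?_, hfg this⟩
  rw [hSol]
  ext m
  rw [Set.mem_ofPred_eq, Set.mem_ofPred_eq, hκ]
  refine ⟨fun h => hn _ ((Submodule.Quotient.mk_eq_zero _).1 h), fun h => ?_⟩
  rw [h, TensorProduct.tmul_zero, Submodule.Quotient.mk_zero]

/-! ### Localization of a primary quotient -/

section Primary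

variable {R : Type v} {M : Type w} [CommRing R] [AddCommGroup M] [Module R M]

theorem IsPrimaryFor.mem_of_smul_mem {p : Ideal R} {U : Submodule R M} (hU : IsPrimaryFor p U)
    {s : R} (hs : s ∉ p) {m : M} (h : s • m ∈ U) : m ∈ U :=
  (hU.1.mem_or_mem h).resolve_right (by rwa [hU.2])

theorem IsPrimaryFor.exists_pow_smul_le [IsNoetherianRing R] {p : Ideal R} {U : Submodule R M}
    (hU : IsPrimaryFor p U) : ∃ n, p ^ n • (⊤ : Submodule R M) ≤ U := by
  obtain ⟨n, hn⟩ := Ideal.exists_radical_pow_le_of_fg (U.colon Set.univ) (IsNoetherian.noetherian _)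
  rw [hU.2] at hn
  exact ⟨n, Submodule.smul_le.2 fun r hr m _ => Submodule.mem_colon.1 (hn hr) m trivial⟩

/-- The map from `M` to the localization of `M / U` at `p`. Its kernel is `U` if `U` is
`p`-primary. -/
noncomputable def toLocalQuotient (p : Ideal R) [p.IsPrime] (U : Submodule R M) :
    M →ₗ[R] LocalizedModule p.primeCompl (M ⧸ U) :=
  LocalizedModule.mkLinearMap p.primeCompl (M ⧸ U) ∘ₗ U.mkQ

theorem IsPrimaryFor.toLocalQuotient_eq_zero_iff {p : Ideal R} [p.IsPrime] {U : Submodule R M}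
    (hU : IsPrimaryFor p U) (m : M) : toLocalQuotient p U m = 0 ↔ m ∈ U := by
  rw [toLocalQuotient, LinearMap.comp_apply, IsLocalizedModule.eq_zero_iff p.primeCompl]
  constructor
  · rintro ⟨s, hs⟩
    refine hU.mem_of_smul_mem s.2 ((Submodule.Quotient.mk_eq_zero U).1 ?_)
    exact hs
  · intro hm
    exact ⟨1, by rw [one_smul]; exact (Submodule.Quotient.mk_eq_zero U).2 hm⟩

theorem pow_maximalIdeal_smul_localQuotient (p : Ideal R) [p.IsPrime] {U : Submodule R M} {n : ℕ}
    (h : p ^ n • (⊤ : Submodule R M) ≤ U) :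
    ∀ t ∈ IsLocalRing.maximalIdeal (Localization.AtPrime p) ^ n,
      ∀ y : LocalizedModule p.primeCompl (M ⧸ U), t • y = 0 := by
  intro t ht y
  rw [← Localization.AtPrime.map_eq_maximalIdeal, ← Ideal.map_pow] at ht
  induction ht using Submodule.span_induction with
  | mem t ht =>
    obtain ⟨r, hr, rfl⟩ := ht
    induction y using LocalizedModule.induction_on with
    | h m s =>
    obtain ⟨m, rfl⟩ := Submodule.Quotient.mk_surjective U m
    rw [algebraMap_smul, LocalizedModule.smul'_mk, ← Submodule.Quotient.mk_smul,
      (Submodule.Quotient.mk_eq_zero U).2 (h (Submodule.smul_mem_smul hr trivial)),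
      LocalizedModule.zero_mk]
  | zero => rw [zero_smul]
  | add a b _ _ ha hb => rw [add_smul, ha, hb, add_zero]
  | smul r a _ ha => rw [smul_assoc, ha, smul_zero]

end Primary

/-! ### Primary submodules as solution sets -/

section Local

variable {A : Type u} {R : Type v} [CommRing A] [CommRing R] [Algebra A R]
variable (p : Ideal R) [p.IsPrime]
variable {M : Type w} [AddCommGroup M] [Module R M] [Module A M] [IsScalarTower A R M]

theorem IsPrimaryFor.exists_submodule_of_isNoetherianRing [IsNoetherianRing R] [Module.Finite R M]
    {U : Submodule R M}
    (hU : IsPrimaryFor p U) {T : Type*} [CommRing T] [IsNoetherianRing T]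
    [Algebra (Localization.AtPrime p) T] [Module.Flat (Localization.AtPrime p) T]
    [Algebra p.ResidueField T] (μ : T →ₐ[p.ResidueField] p.ResidueField)
    (hμ : ∀ s, μ (algebraMap (Localization.AtPrime p) T s) = IsLocalRing.residue _ s)
    (hA : ∀ a : A, algebraMap (Localization.AtPrime p) T (algebraMap A _ a) =
      algebraMap p.ResidueField T (algebraMap A _ a)) :
    ∃ (n : ℕ) (E : Submodule (R ⊗[A] R) (M →ₗ[A] p.ResidueField)),
      E ≤ diffAux A R M p.ResidueField n ∧ Sol (E : Set (M →ₗ[A] p.ResidueField)) = U ∧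
      FGLeft (Localization.AtPrime p) (E : Set (M →ₗ[A] p.ResidueField)) := by
  let S := Localization.AtPrime p
  let W := LocalizedModule p.primeCompl (M ⧸ U)
  have : Module.Finite S W := .of_isLocalizedModule p.primeCompl
    (LocalizedModule.mkLinearMap p.primeCompl (M ⧸ U))
  have : IsArtinian S W := by
    obtain ⟨n, hn⟩ := hU.exists_pow_smul_le
    exact IsLocalRing.isArtinian_of_pow_smul_eq_zero (pow_maximalIdeal_smul_localQuotient p hn)
  obtain ⟨n, E, hE, hSol, hfg⟩ := exists_submodule_of_retraction (A := A) (R := R) (M := M) (S := S)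
    (K := p.ResidueField) (T := T) (W := W) IsLocalRing.residue_surjective
    (fun s hs => (IsLocalRing.residue_eq_zero_iff s).2 hs) μ hμ
    (fun a => by rw [← IsScalarTower.algebraMap_apply A R S, hA])
    (toLocalQuotient p U).toAddMonoidHom (fun r m => by
      rw [algebraMap_smul]
      exact map_smul (toLocalQuotient p U) r m)
  refine ⟨n, E, hE, ?_, hfg⟩
  rw [hSol]
  ext m
  exact hU.toLocalQuotient_eq_zero_iff m

/-- Separation by operators of order less than `n`, from a coefficient field
`σ : k(p) → R_p / p ^ n R_p`: the operators are the functionals linear over `σ`. -/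
theorem IsPrimaryFor.exists_submodule_of_coefficientField {U : Submodule R M}
    (hU : IsPrimaryFor p U) {n : ℕ} (hn : p ^ n • (⊤ : Submodule R M) ≤ U)
    (σ : p.ResidueField →+*
      Localization.AtPrime p ⧸ IsLocalRing.maximalIdeal (Localization.AtPrime p) ^ n)
    (hσ : ∀ s : Localization.AtPrime p, Ideal.Quotient.mk _ s - σ (IsLocalRing.residue _ s) ∈
      (IsLocalRing.maximalIdeal (Localization.AtPrime p)).map (Ideal.Quotient.mk
        (IsLocalRing.maximalIdeal (Localization.AtPrime p) ^ n)))
    (hA : ∀ a : A, σ (algebraMap A _ a) = Ideal.Quotient.mk _ (algebraMap A _ a)) :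
    ∃ E : Submodule (R ⊗[A] R) (M →ₗ[A] p.ResidueField),
      E ≤ diffAux A R M p.ResidueField n ∧ Sol (E : Set (M →ₗ[A] p.ResidueField)) = U := by
  let S := Localization.AtPrime p
  let K := p.ResidueField
  let W := LocalizedModule p.primeCompl (M ⧸ U)
  let I := IsLocalRing.maximalIdeal S ^ n
  let tors : Module.IsTorsionBySet S W I := fun y t =>
    pow_maximalIdeal_smul_localQuotient p hn t t.2 y
  let : Module (S ⧸ I) W := tors.module
  let : Algebra K (S ⧸ I) := σ.toAlgebra
  let : Module K W := Module.compHom W σ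
  have : IsScalarTower K (S ⧸ I) W := .of_algebraMap_smul fun _ _ => rfl
  obtain ⟨E, hE, hSol, -⟩ := exists_submodule_of_functionals (A := A) (R := R) (M := M) (S := S)
    (K := K) (T := S ⧸ I) (Y := W) IsLocalRing.residue_surjective
    ((Ideal.Quotient.mk I).comp (algebraMap R S)) (fun a => by
      rw [RingHom.comp_apply, ← IsScalarTower.algebraMap_apply A R S]
      exact (hA a).symm) (fun r => hσ (algebraMap R S r)) (toLocalQuotient p U).toAddMonoidHom
      (fun r m => by
        change toLocalQuotient p U (r • m) =
          Ideal.Quotient.mk I (algebraMap R S r) • toLocalQuotient p U m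
        rw [map_smul, ← algebraMap_smul S r]
        exact (tors.mk_smul _ _).symm) (n := n) (fun t ht y => by
        rw [← Ideal.map_pow, Ideal.map_quotient_self] at ht
        rw [(Submodule.mem_bot _).1 ht, zero_smul])
  refine ⟨E, hE, ?_⟩
  rw [hSol]
  ext m
  exact hU.toLocalQuotient_eq_zero_iff m

variable {p} in
/-- Operators into `k(p)` with solution set `U` yield operators into `N`: those that vanish on
`U`. -/
theorem exists_submodule_of_residueField [IsNoetherianRing R] [Module.Finite R M]
    [Algebra.EssFiniteType A R] {N : Type x} [AddCommGroup N]
    [Module R N] [Module A N] [IsScalarTower A R N] [Module (R ⧸ p) N] [IsScalarTower R (R ⧸ p) N]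
    [Module.IsTorsionFree (R ⧸ p) N] [Nontrivial N] {U : Submodule R M} {n : ℕ}
    {E : Submodule (R ⊗[A] R) (M →ₗ[A] p.ResidueField)} (hE : E ≤ diffAux A R M p.ResidueField n)
    (hSol : Sol (E : Set (M →ₗ[A] p.ResidueField)) = U) :
    ∃ E' : Submodule (R ⊗[A] R) (M →ₗ[A] N), E' ≤ diffAux A R M N n ∧
      (U : Set M) = Sol (E' : Set (M →ₗ[A] N)) := by
  let V : Submodule (R ⊗[A] R) (M →ₗ[A] N) :=
    { carrier := {δ | ∀ u ∈ U, δ u = 0}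
      zero_mem' := fun _ _ => rfl
      add_mem' := fun ha hb u hu => by rw [LinearMap.add_apply, ha u hu, hb u hu, add_zero]
      smul_mem' := fun t δ hδ => by
        induction t with
        | zero => rw [zero_smul]; exact fun _ _ => rfl
        | add a b ha hb =>
          intro u hu
          rw [add_smul, LinearMap.add_apply, ha u hu, hb u hu, add_zero]
        | tmul r s =>
          intro u hu
          rw [tmul_smul_apply, hδ _ (U.smul_mem s hu), smul_zero] }
  -- An operator `δ` into `k(p)` and the operator `ε` obtained by clearing denominators have the same
  -- zeros, so that `ε` vanishes on `U` as well.
  refine ⟨diffAux A R M N n ⊓ V, inf_le_left, Set.Subset.antisymm (fun u hu δ hδ => hδ.2 u hu) ?_⟩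
  intro m hm
  rw [← hSol]
  intro δ hδ
  obtain ⟨ε, hε, hεδ⟩ := exists_mem_diffAux_of_residueField (N := N) p (hE hδ)
  refine (hεδ m).1 (hm ε ⟨hε, fun u hu => (hεδ u).2 ?_⟩)
  have hu' : u ∈ Sol (E : Set (M →ₗ[A] p.ResidueField)) := by rw [hSol]; exact hu
  exact hu' δ hδ

end Local

/-- `K ⊗_k S` is flat over its right factor. The instances of Mathlib concern the left factor. -/
theorem flat_tensorProduct_includeRight (k K S : Type*) [Field k] [Field K] [CommRing S]
    [Algebra k K] [Algebra k S] :
    letI : Algebra S (K ⊗[k] S) := Algebra.TensorProduct.rightAlgebra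
    Module.Flat S (K ⊗[k] S) := by
  let : Algebra S (K ⊗[k] S) := Algebra.TensorProduct.rightAlgebra
  let e : S ⊗[k] K ≃ₐ[S] K ⊗[k] S :=
    { Algebra.TensorProduct.comm k S K with
      commutes' := fun s => by
        change Algebra.TensorProduct.comm k S K (s ⊗ₜ 1) = 1 ⊗ₜ s
        simp }
  exact Module.Flat.of_linearEquiv e.symm.toLinearEquiv

/-! ### The fraction field of the base ring -/

section BaseField

variable {A : Type u} {R : Type v} [CommRing A] [CommRing R] [Algebra A R]
variable (p : Ideal R) [p.IsPrime]
variable {M : Type w} [AddCommGroup M] [Module R M] [Module A M] [IsScalarTower A R M]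
variable (k : Type*) [Field k] [Algebra A k] [Algebra k (Localization.AtPrime p)]
variable [IsScalarTower A k (Localization.AtPrime p)]

theorem algebraMap_residueField_eq (a : A) :
    algebraMap A p.ResidueField a = algebraMap k p.ResidueField (algebraMap A k a) := by
  rw [IsScalarTower.algebraMap_apply A (Localization.AtPrime p) p.ResidueField,
    IsScalarTower.algebraMap_apply A k (Localization.AtPrime p),
    ← IsScalarTower.algebraMap_apply k (Localization.AtPrime p) p.ResidueField]

variable {p} in
theorem IsPrimaryFor.exists_submodule_of_tensorProduct [IsNoetherianRing R] [Module.Finite R M]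
    [IsNoetherianRing (p.ResidueField ⊗[k] Localization.AtPrime p)]
    {U : Submodule R M} (hU : IsPrimaryFor p U) :
    ∃ (n : ℕ) (E : Submodule (R ⊗[A] R) (M →ₗ[A] p.ResidueField)),
      E ≤ diffAux A R M p.ResidueField n ∧ Sol (E : Set (M →ₗ[A] p.ResidueField)) = U ∧
      FGLeft (Localization.AtPrime p) (E : Set (M →ₗ[A] p.ResidueField)) := by
  let S := Localization.AtPrime p
  let K := p.ResidueField
  let μ : K ⊗[k] S →ₐ[K] K := Algebra.TensorProduct.lift (AlgHom.id K K)
    (IsScalarTower.toAlgHom k S K) fun _ _ => Commute.all _ _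
  -- `S` acts on `K ⊗ S` on the right; since `K` is an `S`-algebra, there is also an action on the
  -- left, which instance search would find.
  refine @IsPrimaryFor.exists_submodule_of_isNoetherianRing A R _ _ _ p _ M _ _ _ _ _ _ U hU
    (K ⊗[k] S) _ _ Algebra.TensorProduct.rightAlgebra (flat_tensorProduct_includeRight k K S) _ μ
    (fun s => ?_) fun a => ?_
  · change μ (1 ⊗ₜ s) = _
    rw [Algebra.TensorProduct.lift_tmul, map_one, one_mul]
    rfl
  · change (1 : K) ⊗ₜ[k] (algebraMap A S a) = (algebraMap A K a) ⊗ₜ[k] (1 : S)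
    rw [algebraMap_residueField_eq p k, IsScalarTower.algebraMap_apply A k S,
      Algebra.algebraMap_eq_smul_one (A := S), Algebra.algebraMap_eq_smul_one (A := K),
      TensorProduct.smul_tmul]

variable {p} in
theorem IsPrimaryFor.exists_submodule_of_formallySmooth [Algebra.FormallySmooth k p.ResidueField]
    {U : Submodule R M} (hU : IsPrimaryFor p U) {n : ℕ}
    (hn : p ^ (n + 1) • (⊤ : Submodule R M) ≤ U) :
    ∃ E : Submodule (R ⊗[A] R) (M →ₗ[A] p.ResidueField),
      E ≤ diffAux A R M p.ResidueField (n + 1) ∧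
      Sol (E : Set (M →ₗ[A] p.ResidueField)) = U := by
  let S := Localization.AtPrime p
  let K := p.ResidueField
  let I : Ideal S := IsLocalRing.maximalIdeal S ^ (n + 1)
  have hI : ∀ s ∈ I, IsScalarTower.toAlgHom k S K s = 0 := fun s hs =>
    (IsLocalRing.residue_eq_zero_iff s).2 (Ideal.pow_le_self n.succ_ne_zero hs)
  let g : S ⧸ I →ₐ[k] K := Ideal.Quotient.liftₐ I (IsScalarTower.toAlgHom k S K) hI
  have hg : ∀ s : S, g (Ideal.Quotient.mk I s) = IsLocalRing.residue S s := fun _ => rfl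
  have hker : RingHom.ker g ≤ (IsLocalRing.maximalIdeal S).map (Ideal.Quotient.mk I) := by
    intro x hx
    obtain ⟨s, rfl⟩ := Ideal.Quotient.mk_surjective x
    rw [RingHom.mem_ker, hg] at hx
    exact Ideal.mem_map_of_mem _ ((IsLocalRing.residue_eq_zero_iff s).1 hx)
  have hsurj : Function.Surjective g := fun y => by
    obtain ⟨s, rfl⟩ := IsLocalRing.residue_surjective y
    exact ⟨Ideal.Quotient.mk I s, hg s⟩
  have hnil : IsNilpotent (RingHom.ker (g : S ⧸ I →+* K)) := by
    refine ⟨n + 1, le_bot_iff.1 ((Ideal.pow_right_mono hker (n + 1)).trans ?_)⟩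
    rw [← Ideal.map_pow, Ideal.map_quotient_self]
  -- Formal smoothness lifts the identity of `K` along the nilpotent thickening `S ⧸ I` of `K`.
  let σ : K →ₐ[k] S ⧸ I := Algebra.FormallySmooth.liftOfSurjective (AlgHom.id k K) g hsurj hnil
  have hσ : ∀ c, g (σ c) = c := Algebra.FormallySmooth.liftOfSurjective_apply _ g hsurj hnil
  refine hU.exists_submodule_of_coefficientField p hn σ.toRingHom (fun s => hker ?_) fun a => ?_
  · rw [RingHom.mem_ker, map_sub, hg]
    exact sub_eq_zero.2 (hσ _).symm
  · change σ (algebraMap A K a) = _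
    rw [algebraMap_residueField_eq p k, AlgHom.commutes, IsScalarTower.algebraMap_apply A k S]
    rfl

variable (A) in
theorem essFiniteType_localization [Algebra.EssFiniteType A R] (k : Type*) [Field k] [Algebra A k]
    [Algebra k (Localization.AtPrime p)] [IsScalarTower A k (Localization.AtPrime p)] :
    Algebra.EssFiniteType k (Localization.AtPrime p) :=
  have : Algebra.EssFiniteType A (Localization.AtPrime p) := .comp A R _
  .of_comp A k _

end BaseField

theorem isScalarTower_quotAlgebra {A : Type u} {R : Type v} [CommRing A] [IsDomain A] [CommRing R]
    [Algebra A R] (p : Ideal R) [p.IsPrime] (hp : p.comap (algebraMap A R) = ⊥) :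
    letI := quotAlgebra p hp
    IsScalarTower A (FractionRing A) (Localization.AtPrime p) :=
  letI := quotAlgebra p hp
  .of_algebraMap_eq fun a => (IsLocalization.lift_eq (M := nonZeroDivisors A) _ a).symm

end DiffOp

theorem theorem3p13
    {A : Type u} {R : Type v} [CommRing A] [IsDomain A] [IsNoetherianRing A]
    [CommRing R] [IsNoetherianRing R] [Algebra A R]
    (hAR : Function.Injective (algebraMap A R))
    (p : Ideal R) [p.IsPrime] (hp : p.comap (algebraMap A R) = ⊥)
    {M : Type w} [AddCommGroup M] [Module R M] [Module A M] [IsScalarTower A R M]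
    [Module.Finite R M] :
    letI : Algebra (FractionRing A) (Localization.AtPrime p) := DiffOp.quotAlgebra p hp
    -- (i)
    (IsNoetherianRing (p.ResidueField ⊗[FractionRing A] Localization.AtPrime p) →
      ∀ U : Submodule R M, DiffOp.IsPrimaryFor p U →
        ∃ E : Submodule (R ⊗[A] R) (M →ₗ[A] p.ResidueField),
          E ≤ DiffOp.DiffAll A R M p.ResidueField ∧
          (U : Set M) = DiffOp.Sol (E : Set (M →ₗ[A] p.ResidueField)) ∧
          DiffOp.FGLeft (Localization.AtPrime p) (E : Set (M →ₗ[A] p.ResidueField))) ∧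
    -- (ii)
    (Algebra.EssFiniteType A R →
      (∀ (N : Type x) [AddCommGroup N] [Module R N] [Module A N] [IsScalarTower A R N]
          [Module (R ⧸ p) N] [IsScalarTower R (R ⧸ p) N]
          [Module.Finite (R ⧸ p) N] [Module.IsTorsionFree (R ⧸ p) N] [Nontrivial N],
        -- (a)
        (∀ U : Submodule R M, DiffOp.IsPrimaryFor p U →
          ∃ E : Submodule (R ⊗[A] R) (M →ₗ[A] N),
            E ≤ DiffOp.DiffAll A R M N ∧
            (U : Set M) = DiffOp.Sol (E : Set (M →ₗ[A] N)) ∧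
            DiffOp.FGLeft R (E : Set (M →ₗ[A] N))) ∧
        -- (b)
        (DiffOp.IsSeparableExt (FractionRing A) p.ResidueField →
          ∀ (n : ℕ) (U : Submodule R M), DiffOp.IsPrimaryFor p U →
            p ^ (n + 1) • (⊤ : Submodule R M) ≤ U →
            ∃ E : Submodule (R ⊗[A] R) (M →ₗ[A] N),
              E ≤ DiffOp.Diff A R M N n ∧
              (U : Set M) = DiffOp.Sol (E : Set (M →ₗ[A] N)))) ∧
      -- the separability hypothesis of (b) is automatic over a perfect field
      (PerfectField (FractionRing A) →
        DiffOp.IsSeparableExt (FractionRing A) p.ResidueField)) := by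
  let : Algebra (FractionRing A) (Localization.AtPrime p) := DiffOp.quotAlgebra p hp
  have := DiffOp.isScalarTower_quotAlgebra p hp
  refine ⟨fun hT U hU => ?_, fun hess => ?_⟩
  · obtain ⟨n, E, hE, hSol, hfg⟩ := hU.exists_submodule_of_tensorProduct (A := A) (FractionRing A)
    exact ⟨E, fun δ hδ => ⟨n, DiffOp.diffAux_mono n.le_succ (hE hδ)⟩, hSol.symm, hfg⟩
  have := DiffOp.essFiniteType_localization A p (FractionRing A)
  have : Algebra.EssFiniteType (FractionRing A) p.ResidueField :=
    .of_surjective (IsScalarTower.toAlgHom (FractionRing A) (Localization.AtPrime p) p.ResidueField)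
      IsLocalRing.residue_surjective
  refine ⟨fun N _ _ _ _ _ _ _ _ _ => ⟨fun U hU => ?_, fun hsep n U hU hn => ?_⟩, fun _ => ?_⟩
  · have : IsNoetherianRing (p.ResidueField ⊗[FractionRing A] Localization.AtPrime p) :=
      Algebra.EssFiniteType.isNoetherianRing p.ResidueField _
    obtain ⟨n, E, hE, hSol, -⟩ := hU.exists_submodule_of_tensorProduct (A := A) (FractionRing A)
    obtain ⟨E', hE', hSol'⟩ := DiffOp.exists_submodule_of_residueField (N := N) hE hSol
    have : Module.Finite R N := .trans (R ⧸ p) N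
    exact ⟨E', fun δ hδ => ⟨n, DiffOp.diffAux_mono n.le_succ (hE' hδ)⟩, hSol',
      DiffOp.fgLeft_of_le hE'⟩
  · have := DiffOp.formallySmooth_of_isSeparableExt hsep
    obtain ⟨E, hE, hSol⟩ := hU.exists_submodule_of_formallySmooth (A := A) (FractionRing A) hn
    exact DiffOp.exists_submodule_of_residueField hE hSol
  · exact DiffOp.isSeparableExt_of_perfectField
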